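/- There are absolute constants $c, C > 0$ such that the following holds. Let $G=(V,E)$ be a finite connected planar graph (simple, undirected) with $N=|V|\ge 2$ vertices. Suppose that every unordered pair of distinct vertices of $G$ exchanges one unit of flow, so that the total flow is $N(N-1)/2$; for each pair one end is chosen, arbitrarily, as the source $s$ and the other as the target $t$. A *routing* distributes, for each source $s$ and target $t$, the unit of flow over the simple paths of $G$ from $s$ to $t$: it is a family of nonnegative weights on these paths with sum $1$. The flow $T(v)$ through a vertex $v$ is the total weight, summed over all pairs, of the paths that contain $v$ (the ends of a path are contained in it), and $M_v=\max_{v\in V}T(v)$ is the maximum vertex flow. *Geodesic routing* is the routing in which flow only follows shortest paths and, at each vertex $v'$ on a shortest path towards the target $t$, is split equally among the neighbours $x$ of $v'$ with $d(x,t)=d(v',t)-1$, where $d$ is the graph metric. Then for geodesic routing $$ c\,N^{3/2}\;\le\; M_v\;\le\; C\,N^2, $$ and, moreover, the same two inequalities, with the same constants, hold for every routing of the traffic on $G$, not only for geodesic routing. -/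

import Mathlib

universe u

namespace SimpleGraph

/-- A drawing of `G` in the Euclidean plane: distinct vertices are distinct points, every edge is a
simple continuous arc joining its two ends, the interior of an arc contains no vertex, and the
interiors of the arcs of two different edges are disjoint. -/
structure PlaneDrawing {V : Type u} (G : SimpleGraph V) where
  point : V → EuclideanSpace ℝ (Fin 2)
  point_injective : Function.Injective point
  arc : G.edgeSet → C(unitInterval, EuclideanSpace ℝ (Fin 2))
  arc_injective : ∀ e, Function.Injective (arc e)
  arc_ends : ∀ e, s(arc e 0, arc e 1) = Sym2.map point e.1
  arc_ne_point : ∀ e, ∀ r ∈ Set.Ioo (0 : unitInterval) 1, ∀ v, arc e r ≠ point v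
  arc_disjoint : ∀ e f, e ≠ f → ∀ r ∈ Set.Ioo (0 : unitInterval) 1,
    ∀ r' ∈ Set.Ioo (0 : unitInterval) 1, arc e r ≠ arc f r'

/-- A graph is planar if it can be drawn in the plane without crossings. -/
def IsPlanar {V : Type u} (G : SimpleGraph V) : Prop := Nonempty G.PlaneDrawing

/-- A choice, for every unordered pair of vertices, of which end is the source (first component)
and which is the target (second component) of the flow of that pair. -/
structure PairOrientation (V : Type u) where
  ends : Sym2 V → V × V
  ends_spec : ∀ e, s((ends e).1, (ends e).2) = e

open Classical in
/-- A (fractional) routing on `G`: for each source `s` and target `t`, one unit of flow is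
distributed over the paths of `G` from `s` to `t`; `weight s t p` is the part carried by `p`. -/
structure Routing {V : Type u} [Fintype V] (G : SimpleGraph V) where
  weight : ∀ s t : V, G.Path s t → ℝ
  weight_nonneg : ∀ s t p, 0 ≤ weight s t p
  sum_weight : ∀ s t, ∑ p : G.Path s t, weight s t p = 1

namespace Routing

variable {V : Type u} [Fintype V] {G : SimpleGraph V}

open Classical in
/-- The part of the unit flow from `s` to `t` that is carried by paths containing `v`
(the ends of a path are contained in it). -/
noncomputable def flowThrough (R : G.Routing) (s t v : V) : ℝ :=
  ∑ p : G.Path s t, if v ∈ p.1.support then R.weight s t p else 0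

open Classical in
/-- The total flow through `v` when every unordered pair of distinct vertices exchanges one
unit of flow. -/
noncomputable def vertexFlow (R : G.Routing) (o : PairOrientation V) (v : V) : ℝ :=
  ∑ e : Sym2 V with ¬ e.IsDiag, R.flowThrough (o.ends e).1 (o.ends e).2 v

/-- The maximum vertex flow. -/
noncomputable def maxVertexFlow (R : G.Routing) (o : PairOrientation V) : ℝ :=
  ⨆ v, R.vertexFlow o v

end Routing

section Geodesic

variable {V : Type u} [Fintype V] (G : SimpleGraph V)

open Classical in
/-- The neighbours of `u` that are one step closer to `t`. -/
noncomputable def nextHops (u t : V) : Finset V :=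
  {x : V | G.Adj u x ∧ G.dist u t = G.dist x t + 1}

variable {G} in
open Classical in
/-- The part of the unit flow from `s` to `t` that follows the given walk, when at every vertex the
flow is split equally among the neighbours one step closer to `t`. -/
noncomputable def geodesicWeight : {s t : V} → G.Walk s t → ℝ
  | _, _, .nil => 1
  | s, t, .cons (v := x) _ p =>
    (if x ∈ G.nextHops s t then ((G.nextHops s t).card : ℝ)⁻¹ else 0) * geodesicWeight p

variable {G}

open Classical in
theorem geodesicWeight_cons {s x t : V} (h : G.Adj s x) (p : G.Walk x t) :
    geodesicWeight (Walk.cons h p) =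
      (if x ∈ G.nextHops s t then ((G.nextHops s t).card : ℝ)⁻¹ else 0) * geodesicWeight p := by
  rw [geodesicWeight]

theorem geodesicWeight_nonneg {s t : V} (p : G.Walk s t) : 0 ≤ geodesicWeight p := by
  induction p with
  | nil => simp [geodesicWeight]
  | cons h p ih =>
    rw [geodesicWeight_cons]
    refine mul_nonneg ?_ ih
    split_ifs <;> positivity

open Classical in
theorem length_eq_dist_of_geodesicWeight_ne_zero {s t : V} (p : G.Walk s t)
    (hp : geodesicWeight p ≠ 0) : p.length = G.dist s t := by
  induction p with
  | nil => simp
  | cons h p ih =>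
    rw [geodesicWeight_cons] at hp
    have h1 := ih (right_ne_zero_of_mul hp)
    have h2 := left_ne_zero_of_mul hp
    have h3 := (ite_ne_right_iff.mp h2).1
    simp only [nextHops, Finset.mem_filter] at h3
    rw [Walk.length_cons, h1, h3.2.2]

theorem nextHops_nonempty (hG : G.Connected) {s t : V} {n : ℕ} (h : G.dist s t = n + 1) :
    (G.nextHops s t).Nonempty := by
  obtain ⟨p, hp⟩ := hG.exists_walk_length_eq_dist s t
  cases p with
  | nil => simp at h
  | cons ha q =>
    rename_i x
    refine ⟨x, ?_⟩
    simp only [nextHops, Finset.mem_filter, Finset.mem_univ, true_and]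
    refine ⟨ha, ?_⟩
    have h1 : G.dist x t ≤ q.length := dist_le q
    obtain ⟨r, hr⟩ := hG.exists_walk_length_eq_dist x t
    have h2 : G.dist s t ≤ (Walk.cons ha r).length := dist_le _
    simp only [Walk.length_cons] at hp h2
    omega

open Classical in
theorem sum_geodesicWeight_finsetWalkLength (hG : G.Connected) (n : ℕ) (s t : V)
    (h : G.dist s t = n) : ∑ p ∈ G.finsetWalkLength n s t, geodesicWeight p = 1 := by
  induction n generalizing s with
  | zero =>
    obtain rfl : s = t := hG.dist_eq_zero_iff.mp h
    simp [finsetWalkLength, geodesicWeight]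
  | succ n ih =>
    rw [finsetWalkLength, Finset.sum_biUnion]
    · have key : ∀ w : G.neighborSet s,
          ∑ p ∈ (G.finsetWalkLength n (w : V) t).map
            ⟨fun p => Walk.cons w.property p, fun _ _ h => eq_of_heq (Walk.cons.inj h).2⟩, geodesicWeight p =
          (if (w : V) ∈ G.nextHops s t then ((G.nextHops s t).card : ℝ)⁻¹ else 0) := by
        intro w
        rw [Finset.sum_map]
        have h1 : ∀ p : G.Walk w t, geodesicWeight (Walk.cons w.property p) =
            (if (w : V) ∈ G.nextHops s t then ((G.nextHops s t).card : ℝ)⁻¹ else 0) *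
              geodesicWeight p := fun p => geodesicWeight_cons _ p
        refine (Finset.sum_congr rfl fun p _ => h1 p).trans ?_
        rw [← Finset.mul_sum]
        split_ifs with hw
        · simp only [nextHops, Finset.mem_filter] at hw
          rw [ih w (by omega), mul_one]
        · simp
      refine (Finset.sum_congr rfl fun w _ => key w).trans ?_
      have hcard : ((G.nextHops s t).card : ℝ) ≠ 0 := by
        have := (nextHops_nonempty hG h).card_pos
        positivity
      rw [← Finset.sum_filter, Finset.sum_const, nsmul_eq_mul]
      have : (Finset.univ.filter fun w : G.neighborSet s => (w : V) ∈ G.nextHops s t).card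
          = (G.nextHops s t).card := by
        refine Finset.card_bij (fun w _ => (w : V)) ?_ ?_ ?_
        · intro a ha
          simpa using ha
        · intro a _ b _ hab
          exact Subtype.ext hab
        · intro b hb
          have hb' := hb
          simp only [nextHops, Finset.mem_filter] at hb'
          exact ⟨⟨b, hb'.2.1⟩, by simpa using hb, rfl⟩
      rw [this, mul_inv_cancel₀ hcard]
    · intro a _ b _ hab
      rw [Function.onFun, Finset.disjoint_left]
      intro p hpa hpb
      obtain ⟨q, _, hq⟩ := Finset.mem_map.mp hpa
      obtain ⟨r, _, hr⟩ := Finset.mem_map.mp hpb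
      apply hab
      have h1 : Walk.cons a.property q = Walk.cons b.property r := hq.trans hr.symm
      exact Subtype.ext (Walk.cons.inj h1).1

open Classical in
theorem sum_geodesicWeight_path (hG : G.Connected) (s t : V) :
    ∑ p : G.Path s t, geodesicWeight p.1 = 1 := by
  rw [← sum_geodesicWeight_finsetWalkLength hG (G.dist s t) s t rfl]
  refine Finset.sum_bij_ne_zero (fun p _ _ => p.1) ?_ ?_ ?_ ?_
  · intro p _ hp
    exact mem_finsetWalkLength_iff.mpr (length_eq_dist_of_geodesicWeight_ne_zero _ hp)
  · intro p _ _ q _ _ hpq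
    exact Subtype.ext hpq
  · intro q hq hq0
    exact ⟨⟨q, q.isPath_of_length_eq_dist (mem_finsetWalkLength_iff.mp hq)⟩,
      Finset.mem_univ _, hq0, rfl⟩
  · intros
    rfl

/-- Geodesic routing: all flow follows shortest paths, and at every vertex it is split equally
among the neighbours one step closer to the target. -/
noncomputable def geodesicRouting (hG : G.Connected) : G.Routing where
  weight _ _ p := geodesicWeight p.1
  weight_nonneg _ _ p := geodesicWeight_nonneg p.1
  sum_weight s t := sum_geodesicWeight_path hG s t

end Geodesic

end SimpleGraph

/-!
# Maximum vertex flow of routings on planar graphs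

The upper bound holds because each of the fewer than `N ^ 2` pairs sends at most one unit through a
vertex.

For the lower bound, choose for every pair of vertices a random path, independently and with the
probabilities given by the routing. For every choice and every five vertices, two of the ten paths
joining them, with four different ends, share a vertex (`SimpleGraph.IsPlanar.exists_mem_support`).
Taking expectations and summing over all five-tuples shows that
`N (N - 1) (N - 2) (N - 3) (N - 4) ≤ 480 * N ^ 2 * M ^ 2`, where `M` is the maximum vertex flow
(`SimpleGraph.Routing.descFactorial_le`), and hence that `M` is at least a constant times
`N ^ (3 / 2)`.

Planarity enters through the van Kampen–Flores theorem for `K₅`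
(`exists_disjoint_edges_inter_nonempty`), because vertex-disjoint paths are drawn as disjoint
curves. It is proved with continuous logarithms. Let `γ a b` be the curve from `p a` to `p b`, and
suppose that curves of disjoint pairs do not meet. The variation `θ v a b` of `log (γ a b - p v)`
along the curve is `φ v b - φ v a + 2 π i n` with `n = n v a b` an integer, where `φ v w` is a
logarithm of `p w - p v`, chosen so that `φ v w - φ w v = ± π i`. For disjoint edges `a b` and `c d`
the difference `γ a b r - γ c d r'` has a continuous logarithm on the unit square, and going around
the boundary gives a linear equation between four of the integers (`IsLogVariation.square`). The
fifteen equations obtained in this way contradict each other (`false_of_square_parity`).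
-/

/-! ### Continuous logarithms -/

instance : ContractibleSpace unitInterval :=
  (convex_Icc (0 : ℝ) 1).contractibleSpace ⟨0, by simp⟩

instance : LocallyPathConnectedSpace unitInterval :=
  (convex_Icc (0 : ℝ) 1).locallyPathConnectedSpace

theorem exists_continuous_log {A : Type*} [TopologicalSpace A] [SimplyConnectedSpace A]
    [LocallyPathConnectedSpace A] (f : C(A, ℂ)) (hf : ∀ a, f a ≠ 0) :
    ∃ L : C(A, ℂ), ∀ a, Complex.exp (L a) = f a := by
  obtain ⟨a₀⟩ : Nonempty A := inferInstance
  obtain ⟨L, ⟨-, hL⟩, -⟩ := Complex.isCoveringMapOn_exp.existsUnique_continuousMap_lifts f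
    (a₀ := a₀) (e₀ := Complex.log (f a₀)) (Complex.exp_log (hf a₀)) hf
  exact ⟨L, congrFun hL⟩

/-- `z` is the variation along the curve `f` of the logarithm: the increment `L 1 - L 0` of a
continuous branch `L` of `log f`. It exists when `f` has no zero, and does not depend on the
branch. Its imaginary part is the total change of angle. -/
def IsLogVariation (f : C(unitInterval, ℂ)) (z : ℂ) : Prop :=
  ∃ L : C(unitInterval, ℂ), (∀ r, Complex.exp (L r) = f r) ∧ L 1 - L 0 = z

theorem exists_isLogVariation (f : C(unitInterval, ℂ)) (hf : ∀ r, f r ≠ 0) :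
    ∃ z, IsLogVariation f z :=
  let ⟨L, hL⟩ := exists_continuous_log f hf
  ⟨_, L, hL, rfl⟩

theorem IsLogVariation.unique {f : C(unitInterval, ℂ)} {z w : ℂ} (hz : IsLogVariation f z)
    (hw : IsLogVariation f w) : z = w := by
  obtain ⟨L, hL, rfl⟩ := hz
  obtain ⟨K, hK, rfl⟩ := hw
  have h0 : f 0 ≠ 0 := by rw [← hL]; exact Complex.exp_ne_zero _
  have hf : ∀ r, f r ≠ 0 := fun r => by rw [← hL]; exact Complex.exp_ne_zero _
  let K' : C(unitInterval, ℂ) := K + ContinuousMap.const _ (L 0 - K 0)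
  obtain ⟨F, -, hF⟩ := Complex.isCoveringMapOn_exp.existsUnique_continuousMap_lifts f
    (a₀ := 0) (e₀ := L 0) (hL 0) hf
  have h1 : L = F := hF L ⟨rfl, funext hL⟩
  have h2 : K' = F := by
    refine hF K' ⟨by simp [K'], funext fun r => ?_⟩
    simp [K', Complex.exp_add, Complex.exp_sub, hL, hK, h0]
  have h3 : L 1 = K' 1 := by rw [h1, h2]
  simp only [K', ContinuousMap.add_apply, ContinuousMap.const_apply] at h3
  rw [h3]; ring

theorem IsLogVariation.neg {f : C(unitInterval, ℂ)} {z : ℂ} (hz : IsLogVariation f z) :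
    IsLogVariation (-f) z := by
  obtain ⟨L, hL, rfl⟩ := hz
  refine ⟨L + ContinuousMap.const _ (Real.pi * Complex.I), fun r => ?_, by simp⟩
  simp [Complex.exp_add, hL]

theorem IsLogVariation.exp_eq {f : C(unitInterval, ℂ)} {z : ℂ} (hz : IsLogVariation f z) :
    Complex.exp z = f 1 / f 0 := by
  obtain ⟨L, hL, rfl⟩ := hz
  rw [Complex.exp_sub, hL, hL]

/-- For disjoint curves `α` and `β` the map `(r, r') ↦ α r - β r'` has a continuous logarithm on the
unit square, whose variation around the boundary is zero. -/
theorem IsLogVariation.square {α β : C(unitInterval, ℂ)} (h : ∀ r r', α r ≠ β r') {w x y z : ℂ}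
    (hw : IsLogVariation (α - ContinuousMap.const _ (β 0)) w)
    (hx : IsLogVariation (β - ContinuousMap.const _ (α 1)) x)
    (hy : IsLogVariation (α - ContinuousMap.const _ (β 1)) y)
    (hz : IsLogVariation (β - ContinuousMap.const _ (α 0)) z) : w + x = z + y := by
  obtain ⟨L, hL⟩ := exists_continuous_log
    (⟨fun q : unitInterval × unitInterval => α q.1 - β q.2, by fun_prop⟩ : C(_, ℂ))
    fun q => sub_ne_zero.mpr (h _ _)
  simp only [ContinuousMap.coe_mk, Prod.forall] at hL
  have hw' := hw.unique ⟨⟨fun r => L (r, 0), by fun_prop⟩, by simp [hL], rfl⟩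
  have hy' := hy.unique ⟨⟨fun r => L (r, 1), by fun_prop⟩, by simp [hL], rfl⟩
  have hx' := hx.neg.unique ⟨⟨fun r => L (1, r), by fun_prop⟩, by simp [hL], rfl⟩
  have hz' := hz.neg.unique ⟨⟨fun r => L (0, r), by fun_prop⟩, by simp [hL], rfl⟩
  simp only [ContinuousMap.coe_mk] at hw' hx' hy' hz'
  rw [hw', hx', hy', hz']
  ring

/-! ### Curves joining five points of the plane -/

/-- The sum of the fifteen equations, one for each pair of disjoint edges of `K₅`, is
contradictory modulo `4`: each `n v a b` occurs in two of them, and the second summand is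
`± 2` if the two edges interleave and `0` otherwise, where exactly one of the three pairs of
disjoint edges on each of the five 4-subsets interleaves. -/
theorem false_of_square_parity (n : Fin 5 → Fin 5 → Fin 5 → ℤ)
    (h : ∀ a b c d : Fin 5, a < b → c < d → a ≠ c → a ≠ d → b ≠ c → b ≠ d →
      2 * (n c a b + n b c d - n a c d - n d a b) + ((if c < b then -1 else 1) +
        (if a < c then -1 else 1) + (if b < d then -1 else 1) + (if d < a then -1 else 1)) = 0) :
    False := by
  have h' : ∀ a b c d : Fin 5, a < b ∧ c < d ∧ a ≠ c ∧ a ≠ d ∧ b ≠ c ∧ b ≠ d →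
      2 * (n c a b + n b c d - n a c d - n d a b) + ((if c < b then -1 else 1) +
        (if a < c then -1 else 1) + (if b < d then -1 else 1) + (if d < a then -1 else 1)) = 0 :=
    fun a b c d h1 => h a b c d h1.1 h1.2.1 h1.2.2.1 h1.2.2.2.1 h1.2.2.2.2.1 h1.2.2.2.2.2
  have e1 := h' 0 1 2 3 (by decide)
  have e2 := h' 0 2 1 3 (by decide)
  have e3 := h' 0 3 1 2 (by decide)
  have e4 := h' 0 1 2 4 (by decide)
  have e5 := h' 0 2 1 4 (by decide)
  have e6 := h' 0 4 1 2 (by decide)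
  have e7 := h' 0 1 3 4 (by decide)
  have e8 := h' 0 3 1 4 (by decide)
  have e9 := h' 0 4 1 3 (by decide)
  have e10 := h' 0 2 3 4 (by decide)
  have e11 := h' 0 3 2 4 (by decide)
  have e12 := h' 0 4 2 3 (by decide)
  have e13 := h' 1 2 3 4 (by decide)
  have e14 := h' 1 3 2 4 (by decide)
  have e15 := h' 1 4 2 3 (by decide)
  simp +decide only [if_true, if_false] at e1 e2 e3 e4 e5 e6 e7 e8 e9 e10 e11 e12 e13 e14 e15
  omega


/-- The van Kampen–Flores theorem for `K₅`: when any two of five points in the plane are joined by a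
curve, some two curves belonging to disjoint pairs meet. The curve from `p i` to `p j` is only known
to lie in the set `K i j`. -/
theorem exists_disjoint_edges_inter_nonempty (p : Fin 5 → ℂ) (hp : Function.Injective p)
    (K : Fin 5 → Fin 5 → Set ℂ)
    (hK : ∀ i j, i < j → JoinedIn (K i j) (p i) (p j)) :
    ∃ a b c d, a < b ∧ c < d ∧ a ≠ c ∧ a ≠ d ∧ b ≠ c ∧ b ≠ d ∧ (K a b ∩ K c d).Nonempty := by
  by_contra! hcon
  have hcurve : ∀ i j, ∃ γ : C(unitInterval, ℂ),
      i < j → γ 0 = p i ∧ γ 1 = p j ∧ ∀ r, γ r ∈ K i j := by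
    intro i j
    by_cases hij : i < j
    · obtain ⟨γ, hγ⟩ := hK i j hij
      exact ⟨γ, fun _ => ⟨γ.source, γ.target, hγ⟩⟩
    · exact ⟨0, fun h => absurd h hij⟩
  choose γ hγ using hcurve
  have hdisj : ∀ a b c d, a < b → c < d → a ≠ c → a ≠ d → b ≠ c → b ≠ d → ∀ r r',
      γ a b r ≠ γ c d r' := by
    intro a b c d hab hcd h1 h2 h3 h4 r r' h
    have h5 : γ a b r ∈ K a b ∩ K c d :=
      ⟨(hγ a b hab).2.2 r, h ▸ (hγ c d hcd).2.2 r'⟩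
    simp [hcon a b c d hab hcd h1 h2 h3 h4] at h5
  have hvertex : ∀ v a b, a < b → v ≠ a → v ≠ b → ∀ r, γ a b r - p v ≠ 0 := by
    intro v a b hab hva hvb r
    rw [sub_ne_zero]
    -- `p v` is an end of the curve that joins it to a point `p d` off the edge `a b`.
    obtain ⟨d, hda, hdb, hdv⟩ : ∃ d, d ≠ a ∧ d ≠ b ∧ d ≠ v := by
      clear * -
      revert v a b
      decide
    rcases lt_or_gt_of_ne hdv with h | h
    · rw [← (hγ d v h).2.1]
      exact hdisj a b d v hab h hda.symm hva.symm hdb.symm hvb.symm r 1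
    · rw [← (hγ v d h).1]
      exact hdisj a b v d hab h hva.symm hda.symm hvb.symm hdb.symm r 0
  have hθ : ∀ v a b, ∃ z, a < b → v ≠ a → v ≠ b →
      IsLogVariation (γ a b - ContinuousMap.const _ (p v)) z := by
    intro v a b
    by_cases h : a < b ∧ v ≠ a ∧ v ≠ b
    · obtain ⟨z, hz⟩ := exists_isLogVariation (γ a b - ContinuousMap.const _ (p v))
        (by simpa using hvertex v a b h.1 h.2.1 h.2.2)
      exact ⟨z, fun _ _ _ => hz⟩
    · exact ⟨0, fun h1 h2 h3 => absurd ⟨h1, h2, h3⟩ h⟩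
  choose θ hθ using hθ
  -- Logarithms `φ v w` of `p w - p v`, normalised so that reversing a pair adds or subtracts `π i`.
  let φ : Fin 5 → Fin 5 → ℂ := fun v w =>
    if v < w then Complex.log (p w - p v) else Complex.log (p v - p w) + Real.pi * Complex.I
  have hφ : ∀ v w, v ≠ w → Complex.exp (φ v w) = p w - p v := by
    intro v w hvw
    have h1 := sub_ne_zero.mpr (hp.ne hvw)
    have h2 := sub_ne_zero.mpr (hp.ne hvw.symm)
    by_cases h : v < w
    · simp [φ, h, Complex.exp_log h2]
    · simp [φ, h, Complex.exp_add, Complex.exp_log h1]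
  have hφ_swap : ∀ v w, v ≠ w →
      φ v w - φ w v = ((if v < w then -1 else 1 : ℤ) : ℂ) * (Real.pi * Complex.I) := by
    intro v w hvw
    rcases lt_or_gt_of_ne hvw with h | h
    · simp [φ, h, h.not_gt]
    · simp [φ, h, h.not_gt]
  have hn : ∀ v a b, ∃ n : ℤ, a < b → v ≠ a → v ≠ b →
      θ v a b = φ v b - φ v a + n * (2 * Real.pi * Complex.I) := by
    intro v a b
    by_cases h : a < b ∧ v ≠ a ∧ v ≠ b
    · obtain ⟨h1, h2, h3⟩ := h
      have h4 : Complex.exp (θ v a b) = Complex.exp (φ v b - φ v a) := by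
        rw [(hθ v a b h1 h2 h3).exp_eq, Complex.exp_sub, hφ v b h3, hφ v a h2]
        simp [(hγ a b h1).1, (hγ a b h1).2.1]
      obtain ⟨n, hn⟩ := Complex.exp_eq_exp_iff_exists_int.mp h4
      exact ⟨n, fun _ _ _ => hn⟩
    · exact ⟨0, fun h1 h2 h3 => absurd ⟨h1, h2, h3⟩ h⟩
  choose n hn using hn
  refine false_of_square_parity n fun a b c d hab hcd hac had hbc hbd => ?_
  have hsq : θ c a b + θ b c d = θ a c d + θ d a b := by
    refine IsLogVariation.square (hdisj a b c d hab hcd hac had hbc hbd) ?_ ?_ ?_ ?_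
    · rw [(hγ c d hcd).1]; exact hθ c a b hab hac.symm hbc.symm
    · rw [(hγ a b hab).2.1]; exact hθ b c d hcd hbc hbd
    · rw [(hγ c d hcd).2.1]; exact hθ d a b hab had.symm hbd.symm
    · rw [(hγ a b hab).1]; exact hθ a c d hcd hac had
  rw [hn c a b hab hac.symm hbc.symm, hn b c d hcd hbc hbd, hn a c d hcd hac had,
    hn d a b hab had.symm hbd.symm] at hsq
  have hπ : (Real.pi * Complex.I : ℂ) ≠ 0 := by simp [Real.pi_ne_zero]
  rw [← @Int.cast_inj ℂ, Int.cast_zero]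
  refine (mul_eq_zero.mp ?_).resolve_right hπ
  have e1 := hφ_swap c b hbc.symm
  have e2 := hφ_swap a c hac
  have e3 := hφ_swap b d hbd
  have e4 := hφ_swap d a had.symm
  simp only [Int.cast_add, Int.cast_mul, Int.cast_sub, Int.cast_ofNat, add_mul]
  rw [← e1, ← e2, ← e3, ← e4]
  linear_combination hsq

/-! ### Drawings of planar graphs -/

theorem Fin.exists_perm_of_pairwise_ne {a b c d : Fin 5} (hab : a ≠ b) (hcd : c ≠ d)
    (hac : a ≠ c) (had : a ≠ d) (hbc : b ≠ c) (hbd : b ≠ d) :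
    ∃ π : Equiv.Perm (Fin 5), π 0 = a ∧ π 1 = b ∧ π 2 = c ∧ π 3 = d := by
  let f : Fin 4 ↪ Fin 5 := ⟨![a, b, c, d], by
    intro i j h
    fin_cases i <;> fin_cases j <;> simp_all⟩
  obtain ⟨π, hπ⟩ := (Equiv.Perm.isMultiplyPretransitive (Fin 5) 4).exists_smul_eq
    Fin.castSuccEmb f
  refine ⟨π, ?_, ?_, ?_, ?_⟩
  · exact DFunLike.congr_fun hπ 0
  · exact DFunLike.congr_fun hπ 1
  · exact DFunLike.congr_fun hπ 2
  · exact DFunLike.congr_fun hπ 3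

namespace SimpleGraph

namespace PlaneDrawing

variable {V : Type u} {G : SimpleGraph V} (D : G.PlaneDrawing)

/-- The part of the plane covered by the drawing of the subgraph induced on `W`:
the points of `W` and the interiors of the arcs with both ends in `W`. -/
def region (W : Set V) : Set (EuclideanSpace ℝ (Fin 2)) :=
  D.point '' W ∪
    {x | ∃ e : G.edgeSet, (∀ v ∈ e.1, v ∈ W) ∧ ∃ r ∈ Set.Ioo (0 : unitInterval) 1, D.arc e r = x}

theorem disjoint_region {W W' : Set V} (h : Disjoint W W') :
    Disjoint (D.region W) (D.region W') := by
  rw [Set.disjoint_left] at h ⊢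
  rintro x (⟨v, hv, rfl⟩ | ⟨e, he, r, hr, rfl⟩) (⟨w, hw, hwx⟩ | ⟨f, hf, r', hr', hx⟩)
  · exact h hv (D.point_injective hwx ▸ hw)
  · exact D.arc_ne_point f r' hr' v hx
  · exact D.arc_ne_point e r hr w hwx.symm
  · by_cases hef : e = f
    · subst hef
      exact h (he _ (Sym2.out_fst_mem e.1)) (hf _ (Sym2.out_fst_mem e.1))
    · exact D.arc_disjoint e f hef r hr r' hr' hx.symm

theorem arc_mem_region {W : Set V} (e : G.edgeSet) (he : ∀ v ∈ e.1, v ∈ W) (r : unitInterval) :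
    D.arc e r ∈ D.region W := by
  have hend : ∀ x, x ∈ s(D.arc e 0, D.arc e 1) → x ∈ D.region W := by
    intro x hx
    rw [D.arc_ends, Sym2.mem_map] at hx
    obtain ⟨v, hv, rfl⟩ := hx
    exact Or.inl ⟨v, he v hv, rfl⟩
  rcases eq_or_ne r 0 with rfl | h0
  · exact hend _ (Sym2.mem_mk_left _ _)
  rcases eq_or_ne r 1 with rfl | h1
  · exact hend _ (Sym2.mem_mk_right _ _)
  · exact Or.inr ⟨e, he, r, ⟨unitInterval.pos_iff_ne_zero.mpr h0,
      unitInterval.lt_one_iff_ne_one.mpr h1⟩, rfl⟩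

theorem joinedIn_region_of_adj {W : Set V} {u v : V} (h : G.Adj u v) (hu : u ∈ W) (hv : v ∈ W) :
    JoinedIn (D.region W) (D.point u) (D.point v) := by
  let e : G.edgeSet := ⟨s(u, v), h⟩
  have h1 : JoinedIn (D.region W) (D.arc e 0) (D.arc e 1) := by
    refine ⟨⟨D.arc e, rfl, rfl⟩, fun r => D.arc_mem_region e ?_ r⟩
    intro w hw
    rcases Sym2.mem_iff.mp hw with rfl | rfl <;> assumption
  have h2 : s(D.arc e 0, D.arc e 1) = s(D.point u, D.point v) := D.arc_ends e
  rcases Sym2.eq_iff.mp h2 with ⟨h3, h4⟩ | ⟨h3, h4⟩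
  · rwa [h3, h4] at h1
  · rw [h3, h4] at h1
    exact h1.symm

theorem joinedIn_region_of_walk {W : Set V} {u v : V} (p : G.Walk u v)
    (hp : ∀ x ∈ p.support, x ∈ W) :
    JoinedIn (D.region W) (D.point u) (D.point v) := by
  induction p with
  | nil => exact JoinedIn.refl (Or.inl ⟨_, hp _ (by simp), rfl⟩)
  | cons h p ih =>
    simp only [Walk.support_cons, List.mem_cons, forall_eq_or_imp] at hp
    exact (D.joinedIn_region_of_adj h hp.1 (hp.2 _ p.start_mem_support)).trans (ih hp.2)

end PlaneDrawing

/-- In a planar graph, among any ten paths that join five vertices pairwise, some two with four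
different ends share a vertex. -/
theorem IsPlanar.exists_mem_support {V : Type u} {G : SimpleGraph V} (hG : G.IsPlanar)
    (o : PairOrientation V) (P : ∀ e : Sym2 V, G.Path (o.ends e).1 (o.ends e).2)
    (x : Fin 5 ↪ V) : ∃ (π : Equiv.Perm (Fin 5)) (v : V),
      v ∈ (P s(x (π 0), x (π 1))).1.support ∧ v ∈ (P s(x (π 2), x (π 3))).1.support := by
  obtain ⟨D⟩ := hG
  let S : Fin 5 → Fin 5 → Set V := fun i j => {v | v ∈ (P s(x i, x j)).1.support}
  let ι : EuclideanSpace ℝ (Fin 2) ≃ₜ ℂ := Complex.orthonormalBasisOneI.repr.symm.toHomeomorph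
  have hS : ∀ i j, JoinedIn (D.region (S i j)) (D.point (x i)) (D.point (x j)) := by
    intro i j
    have h1 : JoinedIn (D.region (S i j)) _ _ :=
      D.joinedIn_region_of_walk (P s(x i, x j)).1 fun v hv => hv
    rcases Sym2.eq_iff.mp (o.ends_spec s(x i, x j)) with ⟨h3, h4⟩ | ⟨h3, h4⟩
    · rwa [h3, h4] at h1
    · rw [h3, h4] at h1
      exact h1.symm
  obtain ⟨a, b, c, d, hab, hcd, hac, had, hbc, hbd, z, hz, hz'⟩ :=
    exists_disjoint_edges_inter_nonempty
    (fun i => ι (D.point (x i))) (ι.injective.comp (D.point_injective.comp x.injective))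
    (fun i j => ι '' D.region (S i j)) (fun i j _ => (hS i j).map ι.continuous)
  obtain ⟨y, hy, rfl⟩ := hz
  obtain ⟨y', hy', hyy⟩ := hz'
  obtain rfl := ι.injective hyy
  obtain ⟨π, rfl, rfl, rfl, rfl⟩ := Fin.exists_perm_of_pairwise_ne hab.ne hcd.ne hac had hbc hbd
  by_contra! hcon
  exact Set.disjoint_left.mp
    (D.disjoint_region (Set.disjoint_left.mpr fun v hv hv' => hcon π v hv hv')) hy hy'

end SimpleGraph

/-! ### Flow through the vertices -/

/-- If the coordinates of a random family `P` are independent, with coordinate `i` distributed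
according to the weights `w i`, then functions of two different coordinates are uncorrelated. -/
theorem sum_prod_weight_mul {ι : Type*} [Fintype ι] [DecidableEq ι] {κ : ι → Type*}
    [∀ i, Fintype (κ i)] (w A : ∀ i, κ i → ℝ) (hw : ∀ i, ∑ k, w i k = 1) {e f : ι} (hef : e ≠ f) :
    ∑ P : ∀ i, κ i, (∏ i, w i (P i)) * (A e (P e) * A f (P f)) =
      (∑ k, w e k * A e k) * ∑ k, w f k * A f k := by
  have key : ∀ g : ι → ℝ, ∏ i, (if i = e ∨ i = f then g i else 1) = g e * g f := by
    intro g
    rw [← Finset.prod_filter, ← Finset.prod_pair hef]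
    congr 1
    ext i
    simp
  calc ∑ P : ∀ i, κ i, (∏ i, w i (P i)) * (A e (P e) * A f (P f))
      = ∑ P : ∀ i, κ i, ∏ i, (w i (P i) * if i = e ∨ i = f then A i (P i) else 1) := by
        refine Finset.sum_congr rfl fun P _ => ?_
        rw [Finset.prod_mul_distrib, key fun i => A i (P i)]
    _ = ∏ i, ∑ k, (w i k * if i = e ∨ i = f then A i k else 1) := by
        rw [Finset.prod_univ_sum, Fintype.piFinset_univ]
    _ = ∏ i, (if i = e ∨ i = f then ∑ k, w i k * A i k else 1) := by
        refine Finset.prod_congr rfl fun i _ => ?_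
        split_ifs <;> simp [hw]
    _ = _ := key fun i => ∑ k, w i k * A i k

namespace SimpleGraph

namespace Routing

variable {V : Type u} [Fintype V] {G : SimpleGraph V}

open Classical in
theorem flowThrough_nonneg (R : G.Routing) (s t v : V) : 0 ≤ R.flowThrough s t v :=
  Finset.sum_nonneg fun p _ => by
    split_ifs
    exacts [R.weight_nonneg _ _ _, le_rfl]

open Classical in
theorem flowThrough_le_one (R : G.Routing) (s t v : V) : R.flowThrough s t v ≤ 1 := by
  rw [← R.sum_weight s t]
  refine Finset.sum_le_sum fun p _ => ?_
  split_ifs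
  exacts [le_rfl, R.weight_nonneg _ _ _]

open Classical in
theorem flowThrough_source (R : G.Routing) (s t : V) : R.flowThrough s t s = 1 := by
  rw [← R.sum_weight s t]
  exact Finset.sum_congr rfl fun p _ => if_pos p.1.start_mem_support

theorem vertexFlow_le_max (R : G.Routing) (o : PairOrientation V) (v : V) :
    R.vertexFlow o v ≤ R.maxVertexFlow o :=
  le_ciSup (f := fun v => R.vertexFlow o v) (Set.finite_range _).bddAbove v

open Classical in
theorem maxVertexFlow_le (R : G.Routing) (o : PairOrientation V) [Nonempty V] :
    R.maxVertexFlow o ≤ (Fintype.card V : ℝ) ^ 2 := by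
  refine ciSup_le fun v => ?_
  calc R.vertexFlow o v ≤ ∑ e : Sym2 V with ¬ e.IsDiag, (1 : ℝ) :=
        Finset.sum_le_sum fun e _ => R.flowThrough_le_one _ _ _
    _ = ((Finset.univ.filter fun e : Sym2 V => ¬ e.IsDiag).card : ℝ) := by simp
    _ ≤ (Fintype.card (V × V) : ℝ) := by
        norm_cast
        refine Finset.card_le_card_of_injOn (t := Finset.univ) o.ends (by simp) ?_
        intro e _ f _ hef
        rw [← o.ends_spec e, ← o.ends_spec f, hef]
    _ = (Fintype.card V : ℝ) ^ 2 := by rw [Fintype.card_prod]; push_cast; ring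

open Classical in
theorem one_le_maxVertexFlow (R : G.Routing) (o : PairOrientation V) [Nontrivial V] :
    1 ≤ R.maxVertexFlow o := by
  obtain ⟨a, b, hab⟩ := exists_pair_ne V
  let e : Sym2 V := s(a, b)
  refine le_trans ?_ (R.vertexFlow_le_max o (o.ends e).1)
  rw [← R.flowThrough_source (o.ends e).1 (o.ends e).2]
  exact Finset.single_le_sum (f := fun e' => R.flowThrough (o.ends e').1 (o.ends e').2 (o.ends e).1)
    (fun _ _ => R.flowThrough_nonneg _ _ _) (by simp [e, hab])

open Classical in
/-- The flow of an unordered pair through `v`, set to `0` on the diagonal. -/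
noncomputable def pairFlow (R : G.Routing) (o : PairOrientation V) (e : Sym2 V) (v : V) : ℝ :=
  if e.IsDiag then 0 else R.flowThrough (o.ends e).1 (o.ends e).2 v

theorem pairFlow_nonneg (R : G.Routing) (o : PairOrientation V) (e : Sym2 V) (v : V) :
    0 ≤ R.pairFlow o e v := by
  rw [pairFlow]
  split_ifs
  exacts [le_rfl, R.flowThrough_nonneg _ _ _]

theorem sum_pairFlow_le (R : G.Routing) (o : PairOrientation V) (v : V) :
    ∑ q : V × V, R.pairFlow o s(q.1, q.2) v ≤ 2 * R.vertexFlow o v := by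
  classical
  have h1 : R.vertexFlow o v = ∑ e : Sym2 V, R.pairFlow o e v := by
    simp only [vertexFlow, pairFlow, Finset.sum_filter, ite_not]
  rw [h1, Finset.mul_sum, ← Finset.sum_fiberwise Finset.univ (fun q : V × V => s(q.1, q.2))]
  refine Finset.sum_le_sum fun e _ => ?_
  rw [Finset.sum_congr rfl (g := fun _ => R.pairFlow o e v) fun q hq => by
    rw [(Finset.mem_filter.mp hq).2], Finset.sum_const, nsmul_eq_mul]
  refine mul_le_mul_of_nonneg_right ?_ (R.pairFlow_nonneg o e v)
  have h2 : (Finset.univ.filter fun q : V × V => s(q.1, q.2) = e) ⊆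
      {o.ends e, (o.ends e).swap} := by
    intro q hq
    have h3 := (Finset.mem_filter.mp hq).2
    rw [← o.ends_spec e, Sym2.eq_iff] at h3
    simpa [Prod.ext_iff] using h3
  exact_mod_cast (Finset.card_le_card h2).trans Finset.card_le_two

/-- For every pair choose a path at random, independently and with the probabilities given by the
routing. The product of two pair flows at `v` is the probability that both paths contain `v`, so the
right-hand side is the expectation of a count that is always at least `1`. -/
theorem one_le_sum_pairFlow (R : G.Routing) (o : PairOrientation V) (hG : G.IsPlanar)
    (x : Fin 5 ↪ V) : 1 ≤ ∑ π : Equiv.Perm (Fin 5), ∑ v,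
      R.pairFlow o s(x (π 0), x (π 1)) v * R.pairFlow o s(x (π 2), x (π 3)) v := by
  classical
  -- The probability of the path `p` for the pair `e`, and the indicator that `p` contains `v`.
  let w : ∀ e : Sym2 V, G.Path (o.ends e).1 (o.ends e).2 → ℝ := fun e => R.weight _ _
  let A : V → ∀ e : Sym2 V, G.Path (o.ends e).1 (o.ends e).2 → ℝ :=
    fun v e p => if v ∈ p.1.support then 1 else 0
  have hw : ∀ e, ∑ p, w e p = 1 := fun e => by
    rw [← R.sum_weight (o.ends e).1 (o.ends e).2]
  have hA : ∀ v e p, 0 ≤ A v e p := fun v e p => by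
    simp only [A]; split_ifs <;> norm_num
  have hflow : ∀ i j v, i ≠ j → R.pairFlow o s(x i, x j) v =
      ∑ p, w s(x i, x j) p * A v s(x i, x j) p := by
    intro i j v hij
    have : ¬ (s(x i, x j)).IsDiag := by simpa using hij
    simp only [pairFlow, this, if_false, flowThrough, w, A, mul_ite, mul_one, mul_zero]
  calc (1 : ℝ) = ∏ e : Sym2 V, ∑ p, w e p := by simp [hw]
    _ = ∑ P : ∀ e : Sym2 V, G.Path (o.ends e).1 (o.ends e).2, ∏ e, w e (P e) := by
        rw [Finset.prod_univ_sum, Fintype.piFinset_univ]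
    _ ≤ ∑ P : ∀ e : Sym2 V, G.Path (o.ends e).1 (o.ends e).2, (∏ e, w e (P e)) *
          ∑ π : Equiv.Perm (Fin 5), ∑ v, (A v s(x (π 0), x (π 1)) (P _) *
            A v s(x (π 2), x (π 3)) (P _)) := by
        refine Finset.sum_le_sum fun P _ => le_mul_of_one_le_right
          (Finset.prod_nonneg fun e _ => R.weight_nonneg _ _ _) ?_
        obtain ⟨π, v, h1, h2⟩ := hG.exists_mem_support o P x
        have h3 : (1 : ℝ) = A v s(x (π 0), x (π 1)) (P _) * A v s(x (π 2), x (π 3)) (P _) := by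
          simp [A, h1, h2]
        have h4 : ∀ (π : Equiv.Perm (Fin 5)) v,
            0 ≤ A v s(x (π 0), x (π 1)) (P _) * A v s(x (π 2), x (π 3)) (P _) :=
          fun _ _ => mul_nonneg (hA _ _ _) (hA _ _ _)
        rw [h3]
        exact (Finset.single_le_sum (f := fun v => A v s(x (π 0), x (π 1)) (P _) *
            A v s(x (π 2), x (π 3)) (P _)) (fun v _ => h4 π v) (Finset.mem_univ v)).trans
          (Finset.single_le_sum (f := fun π : Equiv.Perm (Fin 5) =>
            ∑ v, A v s(x (π 0), x (π 1)) (P _) * A v s(x (π 2), x (π 3)) (P _))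
            (fun π _ => Finset.sum_nonneg fun v _ => h4 π v) (Finset.mem_univ π))
    _ = _ := by
        simp only [Finset.mul_sum]
        rw [Finset.sum_comm]
        refine Finset.sum_congr rfl fun π _ => ?_
        rw [Finset.sum_comm]
        refine Finset.sum_congr rfl fun v _ => ?_
        rw [hflow _ _ _ (by simp), hflow _ _ _ (by simp)]
        refine sum_prod_weight_mul w (A v) hw ?_
        simp

/-- Summing `one_le_sum_pairFlow` over all injections `Fin 5 ↪ V` bounds their number by the second
moment of the vertex flow: the `120` permutations contribute equally, the fifth vertex is free, and
ordered pairs count the flow twice, so `480 = 120 * 2 ^ 2`. -/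
theorem descFactorial_le (R : G.Routing) (o : PairOrientation V) (hG : G.IsPlanar) :
    ((Fintype.card V).descFactorial 5 : ℝ) ≤
      480 * (Fintype.card V : ℝ) ^ 2 * R.maxVertexFlow o ^ 2 := by
  classical
  let X : V → V → V → V → ℝ := fun a b c d =>
    ∑ v, R.pairFlow o s(a, b) v * R.pairFlow o s(c, d) v
  have hX : ∀ a b c d, 0 ≤ X a b c d := fun a b c d => Finset.sum_nonneg fun v _ =>
    mul_nonneg (R.pairFlow_nonneg _ _ _) (R.pairFlow_nonneg _ _ _)
  have hperm : ∀ π : Equiv.Perm (Fin 5),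
      ∑ x : Fin 5 ↪ V, X (x (π 0)) (x (π 1)) (x (π 2)) (x (π 3)) =
        ∑ x : Fin 5 ↪ V, X (x 0) (x 1) (x 2) (x 3) := fun π =>
    Fintype.sum_equiv (Equiv.embeddingCongr π.symm (Equiv.refl V)) _ _ fun x => by
      simp [Equiv.embeddingCongr]
  have hext : ∑ x : Fin 5 ↪ V, X (x 0) (x 1) (x 2) (x 3) ≤
      ∑ q : V × (V × V) × (V × V), X q.2.1.1 q.2.1.2 q.2.2.1 q.2.2.2 := by
    let g : (Fin 5 ↪ V) ↪ V × (V × V) × (V × V) :=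
      ⟨fun x => (x 4, (x 0, x 1), (x 2, x 3)), fun x y hxy => by
        simp only [Prod.mk.injEq] at hxy
        ext i
        fin_cases i <;> simp [hxy]⟩
    refine (Finset.sum_map Finset.univ g fun q => X q.2.1.1 q.2.1.2 q.2.2.1 q.2.2.2).ge.trans ?_
    exact Finset.sum_le_sum_of_subset_of_nonneg (Finset.subset_univ _) fun q _ _ => hX _ _ _ _
  have hsq : ∑ q : V × (V × V) × (V × V), X q.2.1.1 q.2.1.2 q.2.2.1 q.2.2.2 =
      Fintype.card V * ∑ v, (∑ q : V × V, R.pairFlow o s(q.1, q.2) v) ^ 2 := by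
    rw [Fintype.sum_prod_type]
    dsimp only
    rw [Finset.sum_const, nsmul_eq_mul, Finset.card_univ]
    congr 1
    simp only [X]
    rw [Finset.sum_comm]
    refine Finset.sum_congr rfl fun v _ => ?_
    rw [sq, Finset.sum_mul_sum, Fintype.sum_prod_type]
  calc ((Fintype.card V).descFactorial 5 : ℝ) = ∑ x : Fin 5 ↪ V, 1 := by
        simp [Fintype.card_embedding_eq]
    _ ≤ ∑ x : Fin 5 ↪ V, ∑ π : Equiv.Perm (Fin 5), X (x (π 0)) (x (π 1)) (x (π 2)) (x (π 3)) :=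
        Finset.sum_le_sum fun x _ => R.one_le_sum_pairFlow o hG x
    _ = 120 * ∑ x : Fin 5 ↪ V, X (x 0) (x 1) (x 2) (x 3) := by
        rw [Finset.sum_comm, Finset.sum_congr rfl fun π _ => hperm π]
        simp [Fintype.card_perm, Nat.factorial]
    _ ≤ 120 * (Fintype.card V * ∑ v, (∑ q : V × V, R.pairFlow o s(q.1, q.2) v) ^ 2) := by
        rw [← hsq]; gcongr
    _ ≤ 120 * (Fintype.card V * ∑ _v : V, (2 * R.maxVertexFlow o) ^ 2) := by
        gcongr with v
        · exact Finset.sum_nonneg fun q _ => R.pairFlow_nonneg _ _ _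
        · exact (R.sum_pairFlow_le o v).trans (by gcongr; exact R.vertexFlow_le_max o v)
    _ = _ := by
        rw [Finset.sum_const, nsmul_eq_mul, Finset.card_univ]; ring

/-- For `N ≥ 5` the falling factorial `N (N - 1) ⋯ (N - 4)` is at least `(N / 5) ^ 5`, whence
`N ^ 3 ≤ 480 * 5 ^ 5 * M ^ 2 ≤ (2000 * M) ^ 2`. For smaller `N` it suffices that `M ≥ 1`. -/
theorem rpow_le_maxVertexFlow (R : G.Routing) (o : PairOrientation V) (hG : G.IsPlanar)
    (hV : 2 ≤ Fintype.card V) :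
    1 / 2000 * (Fintype.card V : ℝ) ^ (3 / 2 : ℝ) ≤ R.maxVertexFlow o := by
  have : Nontrivial V := Fintype.one_lt_card_iff_nontrivial.mp hV
  have hM := R.one_le_maxVertexFlow o
  have hcube : (Fintype.card V : ℝ) ^ 3 ≤ (2000 * R.maxVertexFlow o) ^ 2 := by
    by_cases hN : Fintype.card V < 5
    · have h1 : (Fintype.card V : ℝ) ≤ 4 := by exact_mod_cast Nat.le_of_lt_succ hN
      calc (Fintype.card V : ℝ) ^ 3 ≤ 4 ^ 3 := by gcongr
        _ ≤ (2000 * 1) ^ 2 := by norm_num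
        _ ≤ _ := by gcongr
    · have h1 := R.descFactorial_le o hG
      obtain ⟨k, hk⟩ := Nat.exists_eq_add_of_le (not_lt.mp hN)
      have h2 : (Fintype.card V : ℝ) ^ 5 ≤ 5 ^ 5 * ((Fintype.card V).descFactorial 5 : ℝ) := by
        rw [hk]
        norm_cast
        simp only [Nat.descFactorial_succ, Nat.descFactorial_zero, mul_one]
        calc (5 + k) ^ 5 = (5 + k) * ((5 + k) * ((5 + k) * ((5 + k) * (5 + k)))) := by ring
          _ ≤ (5 * (5 + k - 4)) * ((5 * (5 + k - 3)) * ((5 * (5 + k - 2)) * ((5 * (5 + k - 1)) *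
              (5 * (5 + k - 0))))) := by gcongr <;> omega
          _ = _ := by ring
      have h3 : (0 : ℝ) < (Fintype.card V : ℝ) ^ 2 := by positivity
      refine le_of_mul_le_mul_right ?_ h3
      nlinarith [mul_nonneg h3.le (sq_nonneg (R.maxVertexFlow o))]
  have h4 : ((Fintype.card V : ℝ) ^ (3 / 2 : ℝ)) ^ 2 = (Fintype.card V : ℝ) ^ 3 := by
    rw [← Real.rpow_natCast, ← Real.rpow_mul (by positivity), ← Real.rpow_natCast]
    norm_num
  have h5 := abs_le_of_sq_le_sq' (h4.trans_le hcube) (by positivity)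
  linarith [h5.2]

end Routing

end SimpleGraph

theorem mainTheorem2 :
    ∃ c C : ℝ, 0 < c ∧ 0 < C ∧
      ∀ (V : Type u) [Fintype V] (G : SimpleGraph V) (hG : G.Connected),
        G.IsPlanar → 2 ≤ Fintype.card V → ∀ o : SimpleGraph.PairOrientation V,
          (c * (Fintype.card V : ℝ) ^ (3 / 2 : ℝ) ≤
              (SimpleGraph.geodesicRouting hG).maxVertexFlow o ∧
            (SimpleGraph.geodesicRouting hG).maxVertexFlow o ≤ C * (Fintype.card V : ℝ) ^ 2) ∧
          ∀ R : G.Routing,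
            c * (Fintype.card V : ℝ) ^ (3 / 2 : ℝ) ≤ R.maxVertexFlow o ∧
              R.maxVertexFlow o ≤ C * (Fintype.card V : ℝ) ^ 2 := by
  refine ⟨1 / 2000, 1, by norm_num, one_pos, fun V _ G hG hplanar hV o => ?_⟩
  have := hG.nonempty
  have key : ∀ R : G.Routing, 1 / 2000 * (Fintype.card V : ℝ) ^ (3 / 2 : ℝ) ≤ R.maxVertexFlow o ∧
      R.maxVertexFlow o ≤ 1 * (Fintype.card V : ℝ) ^ 2 := fun R =>
    ⟨R.rpow_le_maxVertexFlow o hplanar hV, by simpa using R.maxVertexFlow_le o⟩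
  exact ⟨key _, key⟩
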